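/- \textbf{Setting.} For real numbers $a<b$ let $M=S^1\times[a,b]$, $S^1=\mathbb{R}/2\pi\mathbb{Z}$, with coordinates $(x,y)$, carrying the Misner metric $g=dx\,dy-y\,dx^2$, where $dx\,dy=\tfrac12(dx\otimes dy+dy\otimes dx)$. Its null directions are spanned by $\partial_+=\partial_y$ and $\partial_-=-\partial_x-y\,\partial_y$. All functions are real, and $C^\infty(M)$ denotes functions smooth up to the boundary. Let $EL=\{\phi\in C^\infty(M): \partial_\mu(\sqrt{|g|}\,g^{\mu\nu}\partial_\nu\phi)=0\}$ be the space of solutions of the wave equation, and let $$EL^{\mathrm{glob}}=\{F+G:\ F,G\in C^\infty(M),\ \partial_-F=\partial_+G=0\}.$$ Choose a smooth vector field $n=n^x\partial_x+n^y\partial_y$ of $M$ along $\partial M$ that is everywhere transversal to $\partial M$ (i.e. $n^y\ne0$), and let $n^*$ be the covector field along $\partial M$ with $\langle n^*,n\rangle=1$ and $n^*|_{T\partial M}=0$. Put $\Gamma=g^{-1}(n^*,n^*)$, $u=g^{-1}(n^*,\cdot)-\Gamma n$ (a tangent field of $\partial M$), $\mu=\iota_n\mu_g$, where $\mu_g=\sqrt{|g|}\,dx\wedge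 dy$. On $\tilde\Phi=C^\infty(\partial M)\times C^\infty(\partial M)$ consider the presymplectic form $$\tilde\omega((f,f_n),(h,h_n))=\int_{\partial M}\mu\,(\Gamma f_n+u(f))\,h-\int_{\partial M}\mu\,(\Gamma h_n+u(h))\,f ,$$ with $\partial M$ oriented as the boundary of $M$ (outward normal first, $M$ oriented by $dx\wedge dy$). Let $\Phi=\tilde\Phi/\ker\tilde\omega$ with the induced symplectic form $\omega$, let $\pi:C^\infty(M)\to\Phi$ be $\phi\mapsto[(\phi|_{\partial M},\partial_n\phi|_{\partial M})]$, and put $L=\pi(EL)$ (the evolution relation), $L^{\mathrm{glob}}=\pi(EL^{\mathrm{glob}})$. For a subspace $V\subset\Phi$, $V^\perp$ is its $\omega$-orthogonal; $V$ is isotropic if $V\subset V^\perp$ and Lagrangian if $V=V^\perp$. \textbf{Statement.} (1) Let $[a,b]$ be $[-1,1]$, $[-1,0]$ or $[0,1]$ (the Misner cylinder and its two halves). Then $EL=EL^{\mathrm{glob}}$, and $EL$ is also equal to the space of $\phi\in C^\infty(M)$ such that $d\phi=\kappa+\lambda$ for some smooth closed 1-forms $\kappa,\lambda$ with $\iota_{\partial_-}\kappa=\iota_{\partial_+}\lambda=0$.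 For every choice of $n$: $L=L^{\mathrm{glob}}$; $L$ is the set of classes of those boundary data whose restriction to each of the two boundary circles is $(\phi,\phi_n)=(f,\,n^x\,\partial_xf)$, with one and the same $f\in C^\infty(S^1)$ on both circles; $L$ is isotropic; $\dim L^\perp/L=\infty$; in particular $L$ is not Lagrangian. (2) Let $[a,b]=[-1,1]$, $n=2\partial_y-\partial_x$ on the in-boundary $y=-1$ and $n=2\partial_y+\partial_x$ on the out-boundary $y=1$. Then $\ker\tilde\omega=0$, so $\Phi=\tilde\Phi=C^\infty(S^1)^4\ni(\phi^{\mathrm{in}},\phi^{\mathrm{in}}_n,\phi^{\mathrm{out}},\phi^{\mathrm{out}}_n)$; moreover $$\omega(\phi,\psi)=\oint_{S^1}dx\,\bigl(\phi^{\mathrm{in}}_n\psi^{\mathrm{in}}-\phi^{\mathrm{in}}\psi^{\mathrm{in}}_n+\phi^{\mathrm{out}}_n\psi^{\mathrm{out}}-\phi^{\mathrm{out}}\psi^{\mathrm{out}}_n\bigr),$$ $$L=\{(f,\,-\partial_xf,\,f,\,\partial_xf):\ f\in C^\infty(S^1)\},$$ $$L^\perp=\{\phi\in\Phi:\ \partial_x\phi^{\mathrm{in}}-\phi^{\mathrm{in}}_n-\partial_x\phi^{\mathrm{out}}-\phi^{\mathrm{out}}_n=0\}.$$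 -/

import Mathlib

open scoped ContDiff

noncomputable section

namespace WaveCylinder

/-! ### The circle `ℝ / 2πℤ` and the algebra of smooth functions on it -/

/-- The circle `ℝ / 2πℤ`. -/
abbrev S1 : Type := AddCircle (2 * Real.pi)

/-- The algebra `C^∞(S¹)`: real functions on the circle whose pull-back to `ℝ` is smooth. -/
def smoothCircle : Subalgebra ℝ (S1 → ℝ) where
  carrier := {f | ContDiff ℝ ∞ fun t : ℝ => f (t : S1)}
  mul_mem' {f g} hf hg := by
    simp only [Set.mem_ofPred_eq] at hf hg ⊢
    exact hf.mul hg
  add_mem' {f g} hf hg := by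
    simp only [Set.mem_ofPred_eq] at hf hg ⊢
    exact hf.add hg
  algebraMap_mem' c := (contDiff_const : ContDiff ℝ ∞ fun _ : ℝ => c)

/-- The derivative `∂ₓ f` of a function on the circle. -/
def circleDerivFun (f : S1 → ℝ) (θ : S1) : ℝ :=
  deriv (fun t : ℝ => f (θ + (t : S1))) 0

theorem circleDerivFun_coe (f : S1 → ℝ) (x : ℝ) :
    circleDerivFun f (x : S1) = deriv (fun t : ℝ => f (t : S1)) x := by
  have h := deriv_comp_const_add (fun t : ℝ => f (t : S1)) x 0
  simpa [circleDerivFun, AddCircle.coe_add] using h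

theorem smoothCircle_differentiable (f : smoothCircle) :
    Differentiable ℝ fun t : ℝ => f.1 (t : S1) :=
  ContDiff.differentiable (n := ∞) f.2 (by simp)

theorem circleDerivFun_mem (f : smoothCircle) : circleDerivFun f.1 ∈ smoothCircle := by
  change ContDiff ℝ ∞ fun t : ℝ => circleDerivFun f.1 (t : S1)
  simp only [circleDerivFun_coe]
  exact (contDiff_infty_iff_deriv.1 f.2).2

/-- The derivative `∂ₓ : C^∞(S¹) → C^∞(S¹)`. -/
def circleDeriv : smoothCircle →ₗ[ℝ] smoothCircle where
  toFun f := ⟨circleDerivFun f.1, circleDerivFun_mem f⟩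
  map_add' f g := by
    ext θ
    obtain ⟨x, rfl⟩ := QuotientAddGroup.mk_surjective θ
    change circleDerivFun (f.1 + g.1) (x : S1)
      = circleDerivFun f.1 (x : S1) + circleDerivFun g.1 (x : S1)
    simp only [circleDerivFun_coe]
    exact deriv_add (smoothCircle_differentiable f x) (smoothCircle_differentiable g x)
  map_smul' c f := by
    ext θ
    obtain ⟨x, rfl⟩ := QuotientAddGroup.mk_surjective θ
    change circleDerivFun (c • f.1) (x : S1) = c • circleDerivFun f.1 (x : S1)
    simp only [circleDerivFun_coe]
    exact deriv_const_smul c (smoothCircle_differentiable f x)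

/-- The integral `∮ f dx` over the circle, oriented by `dx`. -/
def circleInt : smoothCircle →ₗ[ℝ] ℝ where
  toFun f := ∫ x in (0 : ℝ)..(2 * Real.pi), f.1 (x : S1)
  map_add' f g := intervalIntegral.integral_add
    ((smoothCircle_differentiable f).continuous.intervalIntegrable _ _)
    ((smoothCircle_differentiable g).continuous.intervalIntegrable _ _)
  map_smul' c _ := intervalIntegral.integral_smul c _

/-- The reciprocal of a nowhere vanishing smooth function on the circle. -/
def circleInv (f : smoothCircle) (hf : ∀ θ, f.1 θ ≠ 0) : smoothCircle :=
  ⟨fun θ => (f.1 θ)⁻¹, by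
    have h : ContDiff ℝ ∞ fun t : ℝ => f.1 (t : S1) := f.2
    exact h.inv fun _ => hf _⟩

/-! ### Cylinders, smooth functions up to the boundary, vector fields and 1-forms -/

/-- A compact interval `[lo, hi]` with `lo < hi`, giving the cylinder `S¹ × [lo, hi]`. -/
structure Cylinder where
  lo : ℝ
  hi : ℝ
  lt : lo < hi

namespace Cylinder

variable (C : Cylinder)

/-- The points of the cylinder `S¹ × [lo, hi]`. -/
abbrev Point : Type := S1 × Set.Icc C.lo C.hi

/-- The closed strip `ℝ × [lo, hi]`, the universal cover of the cylinder. -/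
def strip : Set (ℝ × ℝ) := Set.univ ×ˢ Set.Icc C.lo C.hi

variable {C} in
/-- A function on the cylinder in the coordinates `(x, y)`. Only the values on the strip matter. -/
def lift (φ : C.Point → ℝ) (q : ℝ × ℝ) : ℝ :=
  φ ((q.1 : S1), Set.projIcc C.lo C.hi C.lt.le q.2)

/-- The space of fields `C^∞(M)`, `M = S¹ × [lo, hi]`: functions that are smooth up to the
boundary in the coordinates `(x, y)`. -/
def Fields : Subalgebra ℝ (C.Point → ℝ) where
  carrier := {φ | ContDiffOn ℝ ∞ (lift φ) C.strip}
  mul_mem' hf hg := ContDiffOn.mul hf hg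
  add_mem' hf hg := ContDiffOn.add hf hg
  algebraMap_mem' _ := contDiffOn_const

variable {C}

/-- The coordinate derivatives: `∂₀ = ∂ₓ` and `∂₁ = ∂_y` (one-sided at the boundary). -/
def partialFun (i : Fin 2) (φ : C.Point → ℝ) (p : C.Point) : ℝ :=
  if i = 0 then deriv (fun t : ℝ => φ (p.1 + (t : S1), p.2)) 0
  else derivWithin (fun s : ℝ => φ (p.1, Set.projIcc C.lo C.hi C.lt.le s))
    (Set.Icc C.lo C.hi) p.2

/-- The coordinate basis of `ℝ × ℝ`. -/
def basisVec (i : Fin 2) : ℝ × ℝ := if i = 0 then (1, 0) else (0, 1)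

theorem uniqueDiffOn_strip : UniqueDiffOn ℝ C.strip :=
  uniqueDiffOn_univ.prod (uniqueDiffOn_Icc C.lt)

theorem partialFun_eq (i : Fin 2) (φ : C.Fields) (x : ℝ) (y : Set.Icc C.lo C.hi) :
    partialFun i φ.1 ((x : S1), y)
      = fderivWithin ℝ (lift φ.1) C.strip (x, (y : ℝ)) (basisVec i) := by
  have hmem : ((x, (y : ℝ)) : ℝ × ℝ) ∈ C.strip := ⟨Set.mem_univ _, y.2⟩
  have hd : HasFDerivWithinAt (lift φ.1) (fderivWithin ℝ (lift φ.1) C.strip (x, (y : ℝ)))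
      C.strip (x, (y : ℝ)) :=
    ((ContDiffOn.differentiableOn (n := ∞) φ.2 (by simp)) _ hmem).hasFDerivWithinAt
  unfold partialFun basisVec
  split_ifs with hi
  · have hline : HasDerivWithinAt (fun t : ℝ => ((x + t, (y : ℝ)) : ℝ × ℝ)) (1, 0)
        Set.univ 0 := by
      have h1 : HasDerivAt (fun t : ℝ => x + t) 1 0 := (hasDerivAt_id (0 : ℝ)).const_add x
      exact (h1.prodMk (hasDerivAt_const (0 : ℝ) (y : ℝ))).hasDerivWithinAt
    have hd' : HasFDerivWithinAt (lift φ.1) (fderivWithin ℝ (lift φ.1) C.strip (x, (y : ℝ)))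
        C.strip ((fun t : ℝ => ((x + t, (y : ℝ)) : ℝ × ℝ)) 0) := by simpa using hd
    have hmaps : Set.MapsTo (fun t : ℝ => ((x + t, (y : ℝ)) : ℝ × ℝ)) Set.univ C.strip :=
      fun t _ => ⟨Set.mem_univ _, y.2⟩
    have h := hd'.comp_hasDerivWithinAt (0 : ℝ) hline hmaps
    have h' := h.hasDerivAt Filter.univ_mem
    rw [← h'.deriv]
    congr 1
    funext t
    simp [lift, Set.projIcc_of_mem C.lt.le y.2]
  · have hline : HasDerivWithinAt (fun s : ℝ => ((x, s) : ℝ × ℝ)) (0, 1)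
        (Set.Icc C.lo C.hi) (y : ℝ) :=
      ((hasDerivAt_const (y : ℝ) x).prodMk (hasDerivAt_id (y : ℝ))).hasDerivWithinAt
    have h := hd.comp_hasDerivWithinAt (y : ℝ) hline
      (fun s hs => ⟨Set.mem_univ _, hs⟩)
    rw [← h.derivWithin (uniqueDiffOn_Icc C.lt _ y.2)]
    rfl

theorem lift_partialFun (i : Fin 2) (φ : C.Fields) {q : ℝ × ℝ} (hq : q ∈ C.strip) :
    lift (partialFun i φ.1) q = fderivWithin ℝ (lift φ.1) C.strip q (basisVec i) := by
  have h := partialFun_eq i φ q.1 ⟨q.2, hq.2⟩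
  simpa [lift, Set.projIcc_of_mem C.lt.le hq.2] using h

theorem partialFun_mem (i : Fin 2) (φ : C.Fields) : partialFun i φ.1 ∈ C.Fields := by
  have h : ContDiffOn ℝ ∞ (fun q => fderivWithin ℝ (lift φ.1) C.strip q (basisVec i)) C.strip :=
    (ContDiffOn.fderivWithin (n := ∞) φ.2 uniqueDiffOn_strip (by simp)).clm_apply contDiffOn_const
  exact h.congr fun q hq => lift_partialFun i φ hq

theorem differentiableWithinAt_lift (φ : C.Fields) {q : ℝ × ℝ} (hq : q ∈ C.strip) :
    DifferentiableWithinAt ℝ (lift φ.1) C.strip q :=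
  (ContDiffOn.differentiableOn (n := ∞) φ.2 (by simp)) q hq

/-- The coordinate derivatives `∂₀ = ∂ₓ` and `∂₁ = ∂_y` as linear maps `C^∞(M) → C^∞(M)`. -/
def pd (i : Fin 2) : C.Fields →ₗ[ℝ] C.Fields where
  toFun φ := ⟨partialFun i φ.1, partialFun_mem i φ⟩
  map_add' φ ψ := by
    ext ⟨θ, y⟩
    obtain ⟨x, rfl⟩ := QuotientAddGroup.mk_surjective θ
    have hq : ((x, (y : ℝ)) : ℝ × ℝ) ∈ C.strip := ⟨Set.mem_univ _, y.2⟩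
    change partialFun i (φ + ψ).1 ((x : S1), y)
      = partialFun i φ.1 ((x : S1), y) + partialFun i ψ.1 ((x : S1), y)
    rw [partialFun_eq, partialFun_eq, partialFun_eq]
    have := fderivWithin_add (uniqueDiffOn_strip _ hq) (differentiableWithinAt_lift φ hq)
      (differentiableWithinAt_lift ψ hq)
    exact congrArg (fun L : ℝ × ℝ →L[ℝ] ℝ => L (basisVec i)) this
  map_smul' c φ := by
    ext ⟨θ, y⟩
    obtain ⟨x, rfl⟩ := QuotientAddGroup.mk_surjective θ
    have hq : ((x, (y : ℝ)) : ℝ × ℝ) ∈ C.strip := ⟨Set.mem_univ _, y.2⟩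
    change partialFun i (c • φ).1 ((x : S1), y) = c • partialFun i φ.1 ((x : S1), y)
    rw [partialFun_eq, partialFun_eq]
    have := fderivWithin_const_smul (uniqueDiffOn_strip _ hq)
      (differentiableWithinAt_lift φ hq) c
    exact congrArg (fun L : ℝ × ℝ →L[ℝ] ℝ => L (basisVec i)) this

variable (C) in
/-- Smooth vector fields `X = X⁰ ∂ₓ + X¹ ∂_y`. -/
abbrev VectorField : Type := Fin 2 → C.Fields

variable (C) in
/-- Smooth 1-forms `κ = κ₀ dx + κ₁ dy`. -/
abbrev OneForm : Type := Fin 2 → C.Fields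

/-- The exterior derivative `dφ` of a function. -/
def d (φ : C.Fields) : C.OneForm := fun i => pd i φ

/-- Closed 1-forms. -/
def OneForm.IsClosed (κ : C.OneForm) : Prop := pd 0 (κ 1) = pd 1 (κ 0)

/-- The contraction `ι_X κ`. -/
def contract (X : C.VectorField) (κ : C.OneForm) : C.Fields := ∑ i, X i * κ i

/-! ### Lorentzian metrics and the wave equation -/

variable (C) in
/-- A smooth Lorentzian metric on the cylinder, given by its coefficients `g_{ij}` in the
coordinates `(x, y)`; in dimension two, Lorentzian signature means negative determinant. -/
structure LorentzMetric where
  coeff : Matrix (Fin 2) (Fin 2) C.Fields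
  symm : coeff.IsSymm
  det_neg : ∀ p : C.Point, (coeff.map fun f => f.1 p).det < 0

namespace LorentzMetric

variable (g : C.LorentzMetric)

/-- The matrix `(g_{ij}(p))`. -/
def mat (p : C.Point) : Matrix (Fin 2) (Fin 2) ℝ := g.coeff.map fun f => f.1 p

theorem det_smooth : (fun p => (g.mat p).det) ∈ C.Fields := by
  have h : (fun p => (g.mat p).det) = g.coeff.det.1 := by
    funext p
    simp [mat, Matrix.det_fin_two]
  rw [h]
  exact g.coeff.det.2

theorem sqrt_smooth : (fun p => Real.sqrt |(g.mat p).det|) ∈ C.Fields := by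
  have h : (fun p => Real.sqrt |(g.mat p).det|) = fun p => Real.sqrt (-(g.mat p).det) := by
    funext p
    rw [abs_of_neg (show (g.mat p).det < 0 from g.det_neg p)]
  rw [h]
  exact ContDiffOn.sqrt (ContDiffOn.neg g.det_smooth) fun q _ => by
    have := g.det_neg ((q.1 : S1), Set.projIcc C.lo C.hi C.lt.le q.2)
    exact (neg_pos.2 this).ne'

theorem inv_smooth (i j : Fin 2) : (fun p => (g.mat p)⁻¹ i j) ∈ C.Fields := by
  have h : (fun p => (g.mat p)⁻¹ i j)
      = fun p => ((g.mat p).det)⁻¹ * (g.coeff.adjugate i j).1 p := by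
    funext p
    rw [Matrix.inv_def, Matrix.smul_apply, Ring.inverse_eq_inv', smul_eq_mul]
    congr 1
    rw [Matrix.adjugate_fin_two, Matrix.adjugate_fin_two]
    fin_cases i <;> fin_cases j <;> simp [mat]
  rw [h]
  exact ContDiffOn.mul (ContDiffOn.inv g.det_smooth fun q _ => by
    have := g.det_neg ((q.1 : S1), Set.projIcc C.lo C.hi C.lt.le q.2)
    exact this.ne) (g.coeff.adjugate i j).2

/-- The inner product `g(X, Y)` of vector fields. -/
def inner (X Y : C.VectorField) : C.Fields := ∑ i, ∑ j, g.coeff i j * (X i * Y j)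

/-- The density `√|det g|` of the metric volume form `μ_g = √|det g| dx ∧ dy`. -/
def vol : C.Fields := ⟨fun p => Real.sqrt |(g.mat p).det|, g.sqrt_smooth⟩

/-- The coefficients `g^{ij}` of the inverse metric. -/
def ginv (i j : Fin 2) : C.Fields := ⟨fun p => (g.mat p)⁻¹ i j, g.inv_smooth i j⟩

/-- The operator `φ ↦ ∂_μ (√|g| g^{μν} ∂_ν φ)`. -/
def waveOp : C.Fields →ₗ[ℝ] C.Fields :=
  ∑ i, ∑ j, pd i ∘ₗ LinearMap.mulLeft ℝ (g.vol * g.ginv i j) ∘ₗ pd j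

/-- The Euler-Lagrange space `EL`: smooth solutions of the wave equation `d * d φ = 0`. -/
def EL : Submodule ℝ C.Fields := LinearMap.ker g.waveOp

end LorentzMetric

/-! ### The boundary phase space -/

/-- The two boundary circles: `false` is the in-boundary `y = lo`, `true` is the
out-boundary `y = hi`. -/
abbrev Side : Type := Bool

variable (C) in
/-- The `y`-coordinate of a boundary circle. -/
def bdry : Side → Set.Icc C.lo C.hi
  | false => ⟨C.lo, Set.left_mem_Icc.2 C.lt.le⟩
  | true => ⟨C.hi, Set.right_mem_Icc.2 C.lt.le⟩

/-- The sign comparing `dx` with the boundary orientation (outward normal first) on a boundary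
circle, when the cylinder is oriented by `dx ∧ dy`. -/
def sign : Side → ℝ
  | false => 1
  | true => -1

/-- The restriction of a field to a boundary circle. -/
def res (e : Side) : C.Fields →ₗ[ℝ] smoothCircle where
  toFun φ := ⟨fun θ => φ.1 (θ, C.bdry e), by
    have h : ContDiff ℝ ∞ fun t : ℝ => ((t, (C.bdry e : ℝ)) : ℝ × ℝ) :=
      contDiff_id.prodMk contDiff_const
    have h2 := ContDiffOn.comp (g := lift φ.1) (t := C.strip) φ.2 h.contDiffOn
      (s := Set.univ) (fun t _ => ⟨Set.mem_univ _, (C.bdry e).2⟩)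
    have h3 := contDiffOn_univ.1 h2
    change ContDiff ℝ ∞ fun t : ℝ => φ.1 ((t : S1), C.bdry e)
    have h4 : (fun t : ℝ => φ.1 ((t : S1), C.bdry e))
        = lift φ.1 ∘ fun t : ℝ => ((t, (C.bdry e : ℝ)) : ℝ × ℝ) := by
      funext t
      simp [lift]
    rw [h4]
    exact h3⟩
  map_add' _ _ := rfl
  map_smul' _ _ := rfl

/-- A smooth vector field `n = n⁰ ∂ₓ + n¹ ∂_y` of the cylinder along its boundary that is
transversal to the boundary everywhere. -/
structure TransversalField where
  toFun : Side → Fin 2 → smoothCircle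
  transversal : ∀ e θ, (toFun e 1).1 θ ≠ 0

/-- The pre-phase space of the boundary, `(φ, φ_n) ∈ C^∞(∂M) × C^∞(∂M)`, listed by boundary
circle. -/
abbrev PrePhase : Type := Side → smoothCircle × smoothCircle

section Boundary

variable (n : TransversalField)

/-- The derivative `∂_n φ` along the boundary. -/
def normalDeriv (e : Side) (φ : C.Fields) : smoothCircle :=
  ∑ i, n.toFun e i * res e (pd i φ)

/-- The projection `φ ↦ (φ|_∂M, ∂_n φ|_∂M)` to the pre-phase space. -/
def prePi : C.Fields →ₗ[ℝ] PrePhase where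
  toFun φ e := (res e φ, normalDeriv n e φ)
  map_add' φ ψ := by
    funext e
    simp [normalDeriv, mul_add, Finset.sum_add_distrib]
  map_smul' c φ := by
    funext e
    simp [normalDeriv]

/-- The covector field `n*` along the boundary with `⟨n*, n⟩ = 1` and `⟨n*, ∂ₓ⟩ = 0`. -/
def conormal (e : Side) : Fin 2 → smoothCircle :=
  ![0, circleInv (n.toFun e 1) (n.transversal e)]

variable (g : C.LorentzMetric)

/-- The function `Γ = g⁻¹(n*, n*)` on the boundary. -/
def gam (e : Side) : smoothCircle :=
  ∑ i, ∑ j, res e (g.ginv i j) * (conormal n e i * conormal n e j)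

/-- The components of the vector field `u = g⁻¹(n*, •) - Γ n` along the boundary. -/
def uField (e : Side) (j : Fin 2) : smoothCircle :=
  ∑ i, res e (g.ginv i j) * conormal n e i - gam n g e * n.toFun e j

/-- The vector field `u` is tangent to the boundary. -/
theorem uField_tangent (e : Side) : uField n g e 1 = 0 := by
  have h : conormal n e 1 * n.toFun e 1 = 1 := by
    ext θ
    exact inv_mul_cancel₀ (n.transversal e θ)
  have h0 : conormal n e 0 = 0 := rfl
  simp only [uField, gam, Fin.sum_univ_two, h0]
  linear_combination (-(res e (g.ginv 1 1) * conormal n e 1)) * h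

/-- The action of the tangent vector field `u = u⁰ ∂ₓ` on functions on the boundary. -/
def uAct (e : Side) (f : smoothCircle) : smoothCircle := uField n g e 0 * circleDeriv f

/-- The coefficient of `dx` in the volume form `μ = ι_n μ_g = √|g| (n⁰ dy - n¹ dx)` restricted to
the boundary. -/
def muDensity (e : Side) : smoothCircle := -(res e g.vol * n.toFun e 1)

/-- The 1-form `α` on the pre-phase space as a bilinear map:
`(f, h) ↦ ∫_∂M μ (Γ f_n + u(f)) h`, with the induced orientation of the boundary. -/
def alphaForm : PrePhase →ₗ[ℝ] PrePhase →ₗ[ℝ] ℝ :=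
  LinearMap.mk₂ ℝ
    (fun v w => ∑ e, sign e *
      circleInt (muDensity n g e * (gam n g e * (v e).2 + uAct n g e (v e).1) * (w e).1))
    (fun v v' w => by
      rw [← Finset.sum_add_distrib]
      refine Finset.sum_congr rfl fun e _ => ?_
      rw [← mul_add, ← map_add]
      congr 2
      simp only [uAct, Pi.add_apply, Prod.snd_add, Prod.fst_add, map_add]
      ring)
    (fun c v w => by
      rw [Finset.smul_sum]
      refine Finset.sum_congr rfl fun e _ => ?_
      rw [← mul_smul_comm, ← map_smul]
      congr 2
      simp only [uAct, Pi.smul_apply, Prod.smul_snd, Prod.smul_fst, map_smul, mul_smul_comm,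
        ← smul_add, smul_mul_assoc])
    (fun v w w' => by
      simp only [Fintype.sum_bool, Pi.add_apply, Prod.fst_add, mul_add, map_add]
      ring)
    (fun c v w => by
      simp only [Fintype.sum_bool, Pi.smul_apply, Prod.smul_fst, mul_smul_comm, map_smul]
      simp only [smul_eq_mul]
      ring)

/-- The presymplectic form `δα` on the pre-phase space:
`(f, h) ↦ ∫ μ (Γ f_n + u(f)) h - ∫ μ (Γ h_n + u(h)) f`. -/
def preOmega : PrePhase →ₗ[ℝ] PrePhase →ₗ[ℝ] ℝ :=
  alphaForm n g - (alphaForm n g).flip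

theorem preOmega_isAlt : (preOmega n g).IsAlt := fun v => by simp [preOmega]

/-- The phase space `Φ_∂M`: the reduction of the pre-phase space by the kernel of the
presymplectic form. -/
abbrev Phase : Type := PrePhase ⧸ LinearMap.ker (preOmega n g)

/-- The symplectic form on the phase space. -/
def omega : Phase n g →ₗ[ℝ] Phase n g →ₗ[ℝ] ℝ :=
  (preOmega_isAlt n g).isRefl.liftQ₂ (preOmega n g) _ le_rfl

/-- The point of the phase space represented by boundary data. -/
def toPhase : PrePhase →ₗ[ℝ] Phase n g := Submodule.mkQ _

theorem omega_toPhase (v w : PrePhase) :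
    omega n g (toPhase n g v) (toPhase n g w) = preOmega n g v w := rfl

/-- The projection `π : C^∞(M) → Φ_∂M`. -/
def proj : C.Fields →ₗ[ℝ] Phase n g := toPhase n g ∘ₗ prePi n

/-- The evolution relation `L = π(EL)`. -/
def L : Submodule ℝ (Phase n g) := g.EL.map (proj n g)

/-- The symplectic orthogonal of a subspace of the phase space. -/
def orth (V : Submodule ℝ (Phase n g)) : Submodule ℝ (Phase n g) :=
  V.orthogonalBilin (omega n g)

/-- Isotropic subspaces: `V ⊆ V^⊥`. -/
def IsIsotropic (V : Submodule ℝ (Phase n g)) : Prop := V ≤ orth n g V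

/-- Lagrangian subspaces: `V = V^⊥`. -/
def IsLagrangian (V : Submodule ℝ (Phase n g)) : Prop := V = orth n g V

end Boundary

end Cylinder

/-! ### The Misner metric -/

open Cylinder

variable (C : Cylinder)

/-- The coordinate function `y`. -/
def yCoord : C.Fields :=
  ⟨fun p => (p.2 : ℝ), (contDiff_snd.contDiffOn (s := C.strip)).congr fun q hq => by
    simp [lift, Set.projIcc_of_mem C.lt.le hq.2]⟩

/-- The Misner metric `g = dx dy - y dx²`, where `dx dy = (dx ⊗ dy + dy ⊗ dx) / 2`. -/
def misner : C.LorentzMetric where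
  coeff := !![-yCoord C, algebraMap ℝ _ (1 / 2); algebraMap ℝ _ (1 / 2), 0]
  symm := by
    ext i j
    fin_cases i <;> fin_cases j <;> rfl
  det_neg p := by
    simp [Matrix.det_fin_two]

/-- The null vector field `∂₊ = ∂_y`. -/
def nullPlus : C.VectorField := ![0, 1]

/-- The null vector field `∂₋ = -∂ₓ - y ∂_y`. -/
def nullMinus : C.VectorField := ![-1, -yCoord C]

theorem nullPlus_null : (misner C).inner (nullPlus C) (nullPlus C) = 0 := by
  simp [LorentzMetric.inner, misner, nullPlus]

theorem nullMinus_null : (misner C).inner (nullMinus C) (nullMinus C) = 0 := by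
  have h : (algebraMap ℝ C.Fields 2⁻¹) + algebraMap ℝ C.Fields 2⁻¹ = 1 := by
    rw [← map_add]; norm_num
  simp [LorentzMetric.inner, misner, nullMinus]
  linear_combination yCoord C * h

/-- The space `EL^glob` of fields `F + G` with globally defined `F`, `G` such that
`∂₋ F = 0 = ∂₊ G`. -/
def ELglob : Set C.Fields :=
  {φ | ∃ F G : C.Fields, φ = F + G ∧
    contract (nullMinus C) (d F) = 0 ∧ contract (nullPlus C) (d G) = 0}

/-- The fields `φ` with `dφ = κ + λ` for closed 1-forms with `ι_{∂₋} κ = 0 = ι_{∂₊} λ`: the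
primitives `F`, `G` of `κ`, `λ` may be multivalued. -/
def ELmulti : Set C.Fields :=
  {φ | ∃ κ l : C.OneForm, κ.IsClosed ∧ l.IsClosed ∧ d φ = κ + l ∧
    contract (nullMinus C) κ = 0 ∧ contract (nullPlus C) l = 0}

/-- The Misner cylinder `S¹ × [-1, 1]`. -/
def fullCylinder : Cylinder := ⟨-1, 1, by norm_num⟩

/-- The half-cylinder `S¹ × [-1, 0]`. -/
def lowerHalf : Cylinder := ⟨-1, 0, by norm_num⟩

/-- The half-cylinder `S¹ × [0, 1]`. -/
def upperHalf : Cylinder := ⟨0, 1, by norm_num⟩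

/-- The transversal field `n = 2∂_y - ∂ₓ` on the in-boundary and `n = 2∂_y + ∂ₓ` on the
out-boundary. -/
def misnerNormal : TransversalField where
  toFun e := ![algebraMap ℝ _ (if e then 1 else -1), algebraMap ℝ _ 2]
  transversal e θ := by
    change (2 : ℝ) ≠ 0
    norm_num

end WaveCylinder

end

namespace WaveCylinder

open Cylinder

namespace Cylinder

variable {C : Cylinder}

/-! ### Calculus of fields on a cylinder -/

/-! Up to the factor 2 the wave operator of the Misner metric is `φ ↦ ∂_y(∂ₓφ + y ∂_yφ)`, so for a
solution `∂ₓφ + y ∂_yφ` depends on `x` only. If the cylinder meets `y = 0`, evaluating there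
identifies this function with `∂ₓφ(x,0)`, hence `F = φ - φ(·,0)` satisfies `(∂ₓ + y ∂_y)F = 0`. The
orbits `(x + t, y e^t)` spiral onto the circle `y = 0` as `t → -∞`; sampled after whole turns they
give `F(x,y) = F(x, y e^{-2πk}) → F(x,0) = 0`. So the solutions are exactly the functions of `x`
(`eq_pullback_of_mem_EL`), and these lie in `ELglob`.

On a boundary circle put `c = 2y/n^y` and `D = f_n - n^x ∂ₓf`. The integrand of `α` is `-(cD + ∂ₓf)`
times the test function (`alpha_density_misner`). The evolution relation consists of data with `D =
0` and a common `f`, and integration by parts turns `L^⊥` into the single equation `∑ ±(cD + 2∂ₓf) =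
0` (`toPhase_mem_orth_L_iff`). Isotropy is the cancellation of the two signs. At a circle with `y ≠
0` the coefficient `c` is invertible, so `D` there can balance an arbitrary `f` on the other circle.
This embeds `C^∞(S¹)` modulo constants into `L^⊥/L`, which is therefore infinite-dimensional. -/

theorem mem_strip (x : ℝ) (y : Set.Icc C.lo C.hi) : ((x, (y : ℝ)) : ℝ × ℝ) ∈ C.strip :=
  ⟨Set.mem_univ _, y.2⟩

theorem lift_coe (φ : C.Point → ℝ) (x : ℝ) (y : Set.Icc C.lo C.hi) :
    lift φ (x, (y : ℝ)) = φ ((x : S1), y) := by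
  simp [lift]

theorem Fields.ext_coe {φ ψ : C.Fields}
    (h : ∀ (x : ℝ) (y : Set.Icc C.lo C.hi), φ.1 ((x : S1), y) = ψ.1 ((x : S1), y)) : φ = ψ := by
  ext ⟨θ, y⟩
  obtain ⟨x, rfl⟩ := QuotientAddGroup.mk_surjective θ
  exact h x y

/-- Needed for symmetry of second derivatives at the boundary, where they are limits of interior
ones. -/
theorem strip_subset_closure_interior : C.strip ⊆ closure (interior C.strip) := by
  rw [strip, interior_prod_eq, closure_prod_eq, interior_Icc, closure_Ioo C.lt.ne]
  simp

/-- The coordinate derivatives commute. -/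
theorem pd_comm (i j : Fin 2) (φ : C.Fields) : pd i (pd j φ) = pd j (pd i φ) := by
  have key : ∀ (i j : Fin 2) (x : ℝ) (y : Set.Icc C.lo C.hi),
      (pd i (pd j φ)).1 ((x : S1), y) =
        fderivWithin ℝ (fderivWithin ℝ (lift φ.1) C.strip) C.strip (x, (y : ℝ))
          (basisVec i) (basisVec j) := by
    intro i j x y
    have hmem := mem_strip x y
    change partialFun i (pd j φ).1 ((x : S1), y) = _
    rw [partialFun_eq]
    have h1 : fderivWithin ℝ (lift (pd j φ).1) C.strip (x, (y : ℝ)) =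
        fderivWithin ℝ (fun q => fderivWithin ℝ (lift φ.1) C.strip q (basisVec j)) C.strip
          (x, (y : ℝ)) :=
      fderivWithin_congr (fun q hq => lift_partialFun j φ hq) (lift_partialFun j φ hmem)
    have h2 : DifferentiableWithinAt ℝ (fderivWithin ℝ (lift φ.1) C.strip) C.strip (x, (y : ℝ)) :=
      (ContDiffOn.fderivWithin (n := ∞) (m := ∞) φ.2 uniqueDiffOn_strip (by simp)).differentiableOn
        (by simp) _ hmem
    rw [h1, fderivWithin_clm_apply (uniqueDiffOn_strip _ hmem) h2
      (differentiableWithinAt_const _)]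
    simp
  refine Fields.ext_coe fun x y => ?_
  have hmem := mem_strip x y
  have hs : IsSymmSndFDerivWithinAt ℝ (lift φ.1) C.strip (x, (y : ℝ)) :=
    (ContDiffOn.contDiffWithinAt φ.2 hmem).isSymmSndFDerivWithinAt
      (by simp only [minSmoothness_of_isRCLikeNormedField]; exact WithTop.coe_le_coe.2 le_top)
      uniqueDiffOn_strip (strip_subset_closure_interior hmem) hmem
  rw [key, key, hs]

/-- The restriction of a field to the circle at height `y`. -/
def slice (y : Set.Icc C.lo C.hi) (φ : C.Fields) : smoothCircle :=
  ⟨fun θ => φ.1 (θ, y), by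
    have h : ContDiff ℝ ∞ fun t : ℝ => ((t, (y : ℝ)) : ℝ × ℝ) := contDiff_id.prodMk contDiff_const
    have h2 := ContDiffOn.comp (g := lift φ.1) (t := C.strip) φ.2 h.contDiffOn
      (s := Set.univ) (fun t _ => mem_strip t y)
    have h3 : (fun t : ℝ => φ.1 ((t : S1), y)) = lift φ.1 ∘ fun t : ℝ => ((t, (y : ℝ)) : ℝ × ℝ) :=
      funext fun t => (lift_coe φ.1 t y).symm
    change ContDiff ℝ ∞ fun t : ℝ => φ.1 ((t : S1), y)
    rw [h3]
    exact contDiffOn_univ.1 h2⟩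

theorem slice_pd_zero (y : Set.Icc C.lo C.hi) (φ : C.Fields) :
    slice y (pd 0 φ) = circleDeriv (slice y φ) := by
  ext θ
  change partialFun 0 φ.1 (θ, y) = circleDerivFun _ θ
  simp [partialFun, circleDerivFun, slice]

variable (C) in
/-- The field `(x, y) ↦ f x`. -/
def pullback (f : smoothCircle) : C.Fields :=
  ⟨fun p => f.1 p.1, by
    have h : ContDiff ℝ ∞ fun q : ℝ × ℝ => f.1 (q.1 : S1) :=
      ContDiff.comp (g := fun t : ℝ => f.1 (t : S1)) f.2 contDiff_fst
    exact h.contDiffOn⟩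

theorem pd_zero_pullback (f : smoothCircle) :
    pd 0 (pullback C f) = pullback C (circleDeriv f) := by
  ext ⟨θ, y⟩
  rfl

theorem pd_one_pullback (f : smoothCircle) : pd 1 (pullback C f) = 0 := by
  ext ⟨θ, y⟩
  change partialFun 1 (fun p : C.Point => f.1 p.1) (θ, y) = 0
  simp [partialFun]

theorem res_pullback (e : Side) (f : smoothCircle) : res e (pullback C f) = f := rfl

theorem differentiableOn_lift_vertical (φ : C.Fields) (x : ℝ) :
    DifferentiableOn ℝ (fun s : ℝ => lift φ.1 (x, s)) (Set.Icc C.lo C.hi) := fun s hs =>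
  (differentiableWithinAt_lift φ (q := (x, s)) ⟨Set.mem_univ _, hs⟩).comp s
    ((differentiableWithinAt_const x).prodMk differentiableWithinAt_id)
    fun _ hr => ⟨Set.mem_univ _, hr⟩

/-- A field with vanishing `∂_y` is a function of `x`. -/
theorem eq_pullback_of_pd_one_eq_zero {φ : C.Fields} (h : pd 1 φ = 0) (y : Set.Icc C.lo C.hi) :
    φ = pullback C (slice y φ) := by
  have key : ∀ (x : ℝ) (s : Set.Icc C.lo C.hi), φ.1 ((x : S1), s) = lift φ.1 (x, C.lo) := by
    intro x s
    rw [← lift_coe φ.1]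
    refine constant_of_derivWithin_zero (differentiableOn_lift_vertical φ x) (fun t ht => ?_) s s.2
    exact congrFun (congrArg Subtype.val h) ((x : S1), ⟨t, ht.1, ht.2.le⟩)
  refine Fields.ext_coe fun x s => ?_
  change _ = φ.1 ((x : S1), y)
  rw [key, key]

/-! ### Transport along the null field `∂₋`. -/

theorem lift_add_nat_mul_period (φ : C.Point → ℝ) (x s : ℝ) (k : ℕ) :
    lift φ (x + k * (-(2 * Real.pi)), s) = lift φ (x, s) := by
  have h : ((x + k * (-(2 * Real.pi)) : ℝ) : S1) = (x : S1) := by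
    rw [AddCircle.coe_add, ← nsmul_eq_mul, AddCircle.coe_nsmul, AddCircle.coe_neg,
      AddCircle.coe_period]
    simp
  simp only [lift, h]

/-- For `t ≤ 0` the flow contracts towards `y = 0`, so convexity keeps it inside the interval; for
`t > 0` it may leave the cylinder. -/
theorem mul_exp_mem (h0 : (0 : ℝ) ∈ Set.Icc C.lo C.hi) (y : Set.Icc C.lo C.hi) {t : ℝ}
    (ht : t ≤ 0) : (y : ℝ) * Real.exp t ∈ Set.Icc C.lo C.hi := by
  have := (convex_Icc C.lo C.hi).smul_mem_of_zero_mem h0 y.2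
    (t := Real.exp t) ⟨(Real.exp_pos t).le, Real.exp_le_one_iff.2 ht⟩
  simpa [mul_comm] using this

/-- The curve `(x + t, y e^t)` is the integral curve of `∂ₓ + y ∂_y` through `(x, y)`, followed
backwards in time only. -/
theorem lift_flow_eq {F : C.Fields} (h : pd 0 F + yCoord C * pd 1 F = 0)
    (h0 : (0 : ℝ) ∈ Set.Icc C.lo C.hi) (x : ℝ) (y : Set.Icc C.lo C.hi) {t : ℝ} (ht : t ≤ 0) :
    lift F.1 (x + t, y * Real.exp t) = lift F.1 (x, y) := by
  have hderiv : ∀ s ∈ Set.Iic (0 : ℝ), HasDerivWithinAt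
      (fun s : ℝ => lift F.1 (x + s, y * Real.exp s)) 0 (Set.Iic 0) s := by
    intro s hs
    have hmem := mul_exp_mem h0 y hs
    have hq := mem_strip (x + s) ⟨_, hmem⟩
    have hd := (differentiableWithinAt_lift F hq).hasFDerivWithinAt
    have hline : HasDerivWithinAt (fun s : ℝ => ((x + s, y * Real.exp s) : ℝ × ℝ))
        (1, y * Real.exp s) (Set.Iic 0) s :=
      (((hasDerivAt_id s).const_add x).prodMk
        ((Real.hasDerivAt_exp s).const_mul (y : ℝ))).hasDerivWithinAt
    have hmaps : Set.MapsTo (fun s : ℝ => ((x + s, y * Real.exp s) : ℝ × ℝ)) (Set.Iic 0) C.strip :=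
      fun r hr => ⟨Set.mem_univ _, mul_exp_mem h0 y hr⟩
    have hc := hd.comp_hasDerivWithinAt s hline hmaps
    -- The velocity is `∂ₓ + y ∂_y` at the current point, so the derivative along the curve is the
    -- left side of `h` there.
    have hvec : ((1, y * Real.exp s) : ℝ × ℝ) = basisVec 0 + (y * Real.exp s) • basisVec 1 := by
      simp [basisVec]
    have h' := congrFun (congrArg Subtype.val h) (((x + s : ℝ) : S1), ⟨_, hmem⟩)
    change partialFun 0 F.1 _ + (y * Real.exp s) * partialFun 1 F.1 _ = 0 at h'
    rw [partialFun_eq, partialFun_eq] at h'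
    rwa [hvec, map_add, map_smul, smul_eq_mul, h'] at hc
  have := (convex_Iic (0 : ℝ)).is_const_of_fderivWithin_eq_zero (𝕜 := ℝ)
    (fun s hs => (hderiv s hs).differentiableWithinAt)
    (fun s hs => ?_) ht (Set.mem_Iic.2 le_rfl)
  · simpa using this
  · have := (hderiv s hs).hasFDerivWithinAt.fderivWithin (uniqueDiffOn_Iic 0 s hs)
    rw [this]
    ext
    simp

/-- A field annihilated by `∂ₓ + y ∂_y` takes the same value at `(x, y)` and at `(x, 0)`, which is
a limit point of the orbit of `(x, y)`. -/
theorem eq_apply_zero_of_transport {F : C.Fields} (h : pd 0 F + yCoord C * pd 1 F = 0)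
    (h0 : (0 : ℝ) ∈ Set.Icc C.lo C.hi) (x : ℝ) (y : Set.Icc C.lo C.hi) :
    F.1 ((x : S1), y) = F.1 ((x : S1), ⟨0, h0⟩) := by
  rw [← lift_coe F.1, ← lift_coe F.1]
  have hneg : ∀ k : ℕ, (k : ℝ) * (-(2 * Real.pi)) ≤ 0 := fun k =>
    mul_nonpos_of_nonneg_of_nonpos k.cast_nonneg (by linarith [Real.pi_pos])
  have hlim : Filter.Tendsto (fun k : ℕ => (y : ℝ) * Real.exp (k * (-(2 * Real.pi))))
      Filter.atTop (nhds 0) := by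
    have h1 : Filter.Tendsto (fun k : ℕ => Real.exp (k * (-(2 * Real.pi))))
        Filter.atTop (nhds 0) :=
      Real.tendsto_exp_atBot.comp (tendsto_natCast_atTop_atTop.atTop_mul_const_of_neg
        (by linarith [Real.pi_pos]))
    simpa using h1.const_mul (y : ℝ)
  have hcont := ((differentiableOn_lift_vertical F x).continuousOn 0 h0).tendsto.comp
    (tendsto_nhdsWithin_iff.2 ⟨hlim, Filter.Eventually.of_forall fun k => mul_exp_mem h0 y (hneg k)⟩)
  refine tendsto_nhds_unique (tendsto_const_nhds.congr fun k => ?_) hcont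
  change _ = lift F.1 (x, y * Real.exp (k * (-(2 * Real.pi))))
  -- Time `-2πk` is `k` full turns: the circle coordinate returns while the height shrinks.
  rw [← lift_flow_eq h h0 x y (hneg k), lift_add_nat_mul_period]

end Cylinder

/-! ### Solutions of the wave equation -/

variable {C : Cylinder}

/-- The off-diagonal entries are `1/2`, whence `√|g| = 1/2` and the entries `2` and `4y` of the
inverse metric. -/
theorem misner_det (p : C.Point) : ((misner C).mat p).det = -(1 / 4) := by
  simp [LorentzMetric.mat, misner, Matrix.det_fin_two]
  norm_num

theorem misner_vol : (misner C).vol = algebraMap ℝ C.Fields (1 / 2) := by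
  ext p
  change Real.sqrt |((misner C).mat p).det| = 1 / 2
  rw [misner_det, show |(-(1 / 4) : ℝ)| = (1 / 2) ^ 2 by norm_num]
  exact Real.sqrt_sq (by norm_num)

theorem misner_inv (p : C.Point) : ((misner C).mat p)⁻¹ = !![0, 2; 2, 4 * (p.2 : ℝ)] := by
  refine Matrix.inv_eq_right_inv ?_
  ext i j
  fin_cases i <;> fin_cases j <;>
    simp [LorentzMetric.mat, misner, Matrix.mul_apply, yCoord]
  all_goals ring

theorem misner_ginv_zero_zero : (misner C).ginv 0 0 = 0 := by
  ext p
  change ((misner C).mat p)⁻¹ 0 0 = 0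
  simp [misner_inv]

theorem misner_ginv_zero_one : (misner C).ginv 0 1 = algebraMap ℝ C.Fields 2 := by
  ext p
  change ((misner C).mat p)⁻¹ 0 1 = 2
  simp [misner_inv]

theorem misner_ginv_one_zero : (misner C).ginv 1 0 = algebraMap ℝ C.Fields 2 := by
  ext p
  change ((misner C).mat p)⁻¹ 1 0 = 2
  simp [misner_inv]

theorem misner_ginv_one_one : (misner C).ginv 1 1 = algebraMap ℝ C.Fields 4 * yCoord C := by
  ext p
  change ((misner C).mat p)⁻¹ 1 1 = 4 * (p.2 : ℝ)
  simp [misner_inv]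

theorem waveOp_misner (φ : C.Fields) :
    (misner C).waveOp φ = (2 : ℝ) • pd 1 (pd 0 φ + yCoord C * pd 1 φ) := by
  have hc : algebraMap ℝ C.Fields (1 / 2) * algebraMap ℝ C.Fields 2 = 1 := by
    rw [← map_mul]; norm_num
  have hd : algebraMap ℝ C.Fields (1 / 2) * (algebraMap ℝ C.Fields 4 * yCoord C) * pd 1 φ
      = (2 : ℝ) • (yCoord C * pd 1 φ) := by
    rw [← mul_assoc, ← map_mul, Algebra.smul_def, mul_assoc]
    norm_num
  simp only [LorentzMetric.waveOp, Fin.sum_univ_two, LinearMap.add_apply, LinearMap.comp_apply,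
    LinearMap.mulLeft_apply, misner_vol, misner_ginv_zero_zero, misner_ginv_zero_one,
    misner_ginv_one_zero, misner_ginv_one_one, hc, hd, mul_zero, zero_mul, map_zero, one_mul,
    zero_add, map_smul, map_add, pd_comm 0 1 φ]
  module

theorem mem_EL_misner_iff {φ : C.Fields} :
    φ ∈ (misner C).EL ↔ pd 1 (pd 0 φ + yCoord C * pd 1 φ) = 0 := by
  rw [LorentzMetric.EL, LinearMap.mem_ker, waveOp_misner, smul_eq_zero]
  simp

theorem contract_nullMinus (κ : C.OneForm) :
    contract (nullMinus C) κ = -(κ 0 + yCoord C * κ 1) := by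
  simp [contract, nullMinus]
  ring

theorem contract_nullPlus (κ : C.OneForm) : contract (nullPlus C) κ = κ 1 := by
  simp [contract, nullPlus]

theorem ELglob_subset_ELmulti : ELglob C ⊆ ELmulti C := by
  rintro _ ⟨F, G, rfl, hF, hG⟩
  refine ⟨d F, d G, pd_comm 0 1 F, pd_comm 0 1 G, ?_, hF, hG⟩
  funext i
  exact map_add _ _ _

/-- The conditions on `κ` and `λ` give `∂ₓφ + y ∂_yφ = λ₀` and `λ₁ = 0`, and closedness of `λ` then
reads `∂_y λ₀ = 0`. -/
theorem ELmulti_subset_EL : ELmulti C ⊆ ((misner C).EL : Set C.Fields) := by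
  rintro φ ⟨κ, l, -, hl, hd, hκ, hlp⟩
  have h0 : pd 0 φ = κ 0 + l 0 := congrFun hd 0
  have h1 : pd 1 φ = κ 1 + l 1 := congrFun hd 1
  rw [contract_nullMinus, neg_eq_zero] at hκ
  rw [contract_nullPlus] at hlp
  rw [OneForm.IsClosed, hlp, map_zero] at hl
  rw [SetLike.mem_coe, mem_EL_misner_iff, h0, h1, hlp,
    show κ 0 + l 0 + yCoord C * (κ 1 + 0) = l 0 by linear_combination hκ, ← hl]

theorem pullback_mem_ELglob (f : smoothCircle) : pullback C f ∈ ELglob C := by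
  refine ⟨0, pullback C f, (zero_add _).symm, ?_, ?_⟩
  · simp [contract_nullMinus, d]
  · rw [contract_nullPlus]
    exact pd_one_pullback f

/-- On a Misner cylinder meeting `y = 0` every solution of the wave equation is a function
of `x`. -/
theorem eq_pullback_of_mem_EL (h0 : (0 : ℝ) ∈ Set.Icc C.lo C.hi) {φ : C.Fields}
    (hφ : φ ∈ (misner C).EL) : φ = pullback C (slice ⟨0, h0⟩ φ) := by
  have hc := eq_pullback_of_pd_one_eq_zero (mem_EL_misner_iff.1 hφ) ⟨0, h0⟩
  -- At height `0` the term `y ∂_yφ` drops out, which identifies the function of `x` found in `hc`.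
  have hs : slice ⟨0, h0⟩ (pd 0 φ + yCoord C * pd 1 φ) = circleDeriv (slice ⟨0, h0⟩ φ) := by
    rw [← slice_pd_zero]
    ext θ
    simp [slice, yCoord]
  rw [hs] at hc
  have hF : pd 0 (φ - pullback C (slice ⟨0, h0⟩ φ))
      + yCoord C * pd 1 (φ - pullback C (slice ⟨0, h0⟩ φ)) = 0 := by
    rw [map_sub, map_sub, pd_zero_pullback, pd_one_pullback]
    linear_combination hc
  refine Fields.ext_coe fun x y => ?_
  have h := eq_apply_zero_of_transport hF h0 x y
  change φ.1 ((x : S1), y) - φ.1 ((x : S1), ⟨0, h0⟩)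
    = φ.1 ((x : S1), ⟨0, h0⟩) - φ.1 ((x : S1), ⟨0, h0⟩) at h
  change φ.1 ((x : S1), y) = φ.1 ((x : S1), ⟨0, h0⟩)
  linarith

theorem mem_EL_iff_exists_pullback (h0 : (0 : ℝ) ∈ Set.Icc C.lo C.hi) {φ : C.Fields} :
    φ ∈ (misner C).EL ↔ ∃ f, pullback C f = φ :=
  ⟨fun h => ⟨_, (eq_pullback_of_mem_EL h0 h).symm⟩, by
    rintro ⟨f, rfl⟩
    exact ELmulti_subset_EL (ELglob_subset_ELmulti (pullback_mem_ELglob f))⟩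

theorem EL_eq_ELglob (h0 : (0 : ℝ) ∈ Set.Icc C.lo C.hi) :
    ((misner C).EL : Set C.Fields) = ELglob C := by
  refine Set.Subset.antisymm (fun φ h => ?_) (ELglob_subset_ELmulti.trans ELmulti_subset_EL)
  obtain ⟨f, rfl⟩ := (mem_EL_iff_exists_pullback h0).1 h
  exact pullback_mem_ELglob f

theorem EL_eq_ELmulti (h0 : (0 : ℝ) ∈ Set.Icc C.lo C.hi) :
    ((misner C).EL : Set C.Fields) = ELmulti C :=
  Set.Subset.antisymm ((EL_eq_ELglob h0).trans_subset ELglob_subset_ELmulti) ELmulti_subset_EL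

end WaveCylinder

namespace WaveCylinder

open Cylinder

/-! ### Smooth functions on the circle -/

theorem smoothCircle_ext_coe {f h : smoothCircle} (H : ∀ x : ℝ, f.1 (x : S1) = h.1 (x : S1)) :
    f = h := by
  ext θ
  obtain ⟨x, rfl⟩ := QuotientAddGroup.mk_surjective θ
  exact H x

theorem hasDerivAt_smoothCircle (f : smoothCircle) (x : ℝ) :
    HasDerivAt (fun t : ℝ => f.1 (t : S1)) ((circleDeriv f).1 (x : S1)) x := by
  have := (smoothCircle_differentiable f x).hasDerivAt
  rwa [← circleDerivFun_coe] at this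

theorem circleDeriv_mul (f h : smoothCircle) :
    circleDeriv (f * h) = f * circleDeriv h + h * circleDeriv f := by
  refine smoothCircle_ext_coe fun x => ?_
  have h1 := (hasDerivAt_smoothCircle f x).mul (hasDerivAt_smoothCircle h x)
  have h2 := (hasDerivAt_smoothCircle (f * h) x).unique h1
  refine h2.trans ?_
  change _ = f.1 (x : S1) * (circleDeriv h).1 (x : S1) + h.1 (x : S1) * (circleDeriv f).1 (x : S1)
  ring

theorem smoothCircle_continuous (f : smoothCircle) : Continuous fun t : ℝ => f.1 (t : S1) :=
  (smoothCircle_differentiable f).continuous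

theorem circleInt_circleDeriv (f : smoothCircle) : circleInt (circleDeriv f) = 0 := by
  change ∫ x in (0 : ℝ)..(2 * Real.pi), (circleDeriv f).1 (x : S1) = 0
  rw [intervalIntegral.integral_eq_sub_of_hasDerivAt (fun x _ => hasDerivAt_smoothCircle f x)
    ((smoothCircle_continuous (circleDeriv f)).intervalIntegrable _ _)]
  simp [AddCircle.coe_period]

/-- Integration by parts on the circle. -/
theorem circleInt_mul_circleDeriv (f h : smoothCircle) :
    circleInt (f * circleDeriv h) = -circleInt (h * circleDeriv f) := by
  rw [eq_neg_iff_add_eq_zero, ← map_add, ← circleDeriv_mul, circleInt_circleDeriv]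

/-- The pairing `∮ f h dx` is nondegenerate. -/
theorem eq_zero_of_circleInt_mul_self {f : smoothCircle} (h : circleInt (f * f) = 0) : f = 0 := by
  have hpos : (0 : ℝ) < 2 * Real.pi := by positivity
  have hz : ∀ x ∈ Set.Icc (0 : ℝ) (2 * Real.pi), f.1 (x : S1) = 0 := by
    intro x hx
    by_contra hne
    refine (intervalIntegral.integral_pos hpos (smoothCircle_continuous (f * f)).continuousOn
      (fun y _ => mul_self_nonneg (f.1 (y : S1))) ⟨x, hx, ?_⟩).ne' h
    exact mul_self_pos.2 hne
  ext θ
  have : Fact ((0 : ℝ) < 2 * Real.pi) := ⟨hpos⟩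
  obtain ⟨x, hx, rfl⟩ := AddCircle.coe_image_Icc_eq (2 * Real.pi) 0 ▸ Set.mem_univ θ
  exact hz x (by simpa using hx)

theorem eq_zero_of_forall_circleInt_mul {f : smoothCircle} (h : ∀ k, circleInt (f * k) = 0) :
    f = 0 :=
  eq_zero_of_circleInt_mul_self (h f)

/-- The function `sin (k x)` on the circle. -/
noncomputable def circleSin (k : ℕ) : smoothCircle :=
  ⟨fun θ => Real.Angle.sin (k • (θ : Real.Angle)), by
    change ContDiff ℝ ∞ fun t : ℝ => Real.Angle.sin (k • (t : Real.Angle))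
    have : (fun t : ℝ => Real.Angle.sin (k • (t : Real.Angle))) = fun t => Real.sin (k * t) := by
      funext t
      rw [← Real.Angle.coe_nsmul, Real.Angle.sin_coe, nsmul_eq_mul]
    rw [this]
    exact Real.contDiff_sin.comp (contDiff_const.mul contDiff_id)⟩

theorem circleSin_coe (k : ℕ) (x : ℝ) : (circleSin k).1 (x : S1) = Real.sin (k * x) := by
  change Real.Angle.sin (k • (x : Real.Angle)) = _
  rw [← Real.Angle.coe_nsmul, Real.Angle.sin_coe, nsmul_eq_mul]

theorem circleDeriv_circleSin_coe (k : ℕ) (x : ℝ) :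
    (circleDeriv (circleSin k)).1 (x : S1) = k * Real.cos (k * x) := by
  have h1 := hasDerivAt_smoothCircle (circleSin k) x
  simp only [circleSin_coe] at h1
  have h2 : HasDerivAt (fun t : ℝ => Real.sin (k * t)) (Real.cos (k * x) * (k * 1)) x :=
    (Real.hasDerivAt_sin _).comp x ((hasDerivAt_id x).const_mul (k : ℝ))
  rw [h1.unique h2]
  ring

theorem circleDeriv_circleDeriv_circleSin (k : ℕ) :
    circleDeriv (circleDeriv (circleSin k)) = (-(k : ℝ) ^ 2) • circleSin k := by
  refine smoothCircle_ext_coe fun x => ?_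
  have h1 := hasDerivAt_smoothCircle (circleDeriv (circleSin k)) x
  simp only [circleDeriv_circleSin_coe] at h1
  have h2 : HasDerivAt (fun t : ℝ => (k : ℝ) * Real.cos (k * t))
      (k * (-Real.sin (k * x) * (k * 1))) x :=
    ((Real.hasDerivAt_cos _).comp x ((hasDerivAt_id x).const_mul (k : ℝ))).const_mul _
  rw [h1.unique h2]
  change _ = -(k : ℝ) ^ 2 * (circleSin k).1 (x : S1)
  rw [circleSin_coe]
  ring

/-- The derivatives of `sin (k x)`, `k ≥ 1`, are linearly independent, being eigenvectors of
`∂ₓ²`. -/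
theorem linearIndependent_circleDeriv_circleSin :
    LinearIndependent ℝ fun k : ℕ => circleDeriv (circleSin (k + 1)) := by
  refine Module.End.eigenvectors_linearIndependent' (circleDeriv ∘ₗ circleDeriv)
    (fun k : ℕ => -((k + 1 : ℕ) : ℝ) ^ 2) ?_ _ fun k => ?_
  · intro i j hij
    have h : ((i + 1 : ℕ) : ℝ) ^ 2 = ((j + 1 : ℕ) : ℝ) ^ 2 := neg_injective hij
    have h' : (i + 1) ^ 2 = (j + 1) ^ 2 := by exact_mod_cast h
    have := Nat.pow_left_injective two_ne_zero h'
    omega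
  · rw [Module.End.hasEigenvector_iff, Module.End.mem_eigenspace_iff]
    refine ⟨?_, fun h => ?_⟩
    · rw [LinearMap.comp_apply, circleDeriv_circleDeriv_circleSin, map_smul]
    -- The eigenvector is nonzero because its value at `x = 0` is `k + 1`; the shift discards the
    -- zero function `sin (0 x)`.
    · have h0 := circleDeriv_circleSin_coe (k + 1) 0
      rw [h, mul_zero, Real.cos_zero, mul_one] at h0
      have : (0 : ℝ) = ((k + 1 : ℕ) : ℝ) := h0
      exact (Nat.cast_ne_zero.2 k.succ_ne_zero) this.symm

/-- A linear map on `C^∞(S¹)` whose kernel consists of constants has infinite-dimensional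
target. -/
theorem not_finiteDimensional_of_ker_le {W : Type*} [AddCommGroup W] [Module ℝ W]
    (T : smoothCircle →ₗ[ℝ] W) (hT : LinearMap.ker T ≤ LinearMap.ker circleDeriv) :
    ¬ FiniteDimensional ℝ W := by
  intro hW
  have hli : LinearIndependent ℝ fun k : ℕ => T (circleSin (k + 1)) := by
    rw [linearIndependent_iff]
    intro l hl
    -- A relation among the images under `T` puts a combination of sines in `ker T ≤ ker ∂ₓ`, hence
    -- gives the same relation among their derivatives.
    refine linearIndependent_iff.1 linearIndependent_circleDeriv_circleSin l ?_
    rw [show (fun k : ℕ => T (circleSin (k + 1))) = T ∘ fun k => circleSin (k + 1) from rfl,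
      ← Finsupp.apply_linearCombination] at hl
    rw [show (fun k : ℕ => circleDeriv (circleSin (k + 1)))
        = circleDeriv ∘ fun k => circleSin (k + 1) from rfl,
      ← Finsupp.apply_linearCombination]
    exact hT hl
  exact hli.finite.false

/-! ### The presymplectic form of the Misner metric -/

variable (C : Cylinder) (n : TransversalField)

/-- The coefficient `2 y / n^y` on a boundary circle. -/
noncomputable def boundaryCoeff (e : Side) : smoothCircle :=
  (2 * (C.bdry e : ℝ)) • circleInv (n.toFun e 1) (n.transversal e)

/-- The deviation `f_n - n^x ∂ₓ f` of boundary data from those of a function of `x`. -/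
noncomputable def deviation (e : Side) : PrePhase →ₗ[ℝ] smoothCircle where
  toFun v := (v e).2 - n.toFun e 0 * circleDeriv (v e).1
  map_add' v w := by simp; ring
  map_smul' c v := by simp [smul_sub]

theorem deviation_apply (e : Side) (v : PrePhase) :
    deviation n e v = (v e).2 - n.toFun e 0 * circleDeriv (v e).1 := rfl

theorem circleInv_mul (e : Side) :
    circleInv (n.toFun e 1) (n.transversal e) * n.toFun e 1 = 1 := by
  ext θ
  exact inv_mul_cancel₀ (n.transversal e θ)

theorem res_algebraMap {C : Cylinder} (e : Side) (c : ℝ) :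
    res e (algebraMap ℝ C.Fields c) = algebraMap ℝ smoothCircle c := rfl

theorem res_mul {C : Cylinder} (e : Side) (φ ψ : C.Fields) :
    res e (φ * ψ) = res e φ * res e ψ := rfl

theorem res_yCoord (e : Side) :
    res e (yCoord C) = algebraMap ℝ smoothCircle (C.bdry e : ℝ) := rfl

/-- Here `n* = dy/n^y`, so `Γ = 4y/(n^y)²`, `u^x = 2/n^y - Γ n^x` and `μ = -(n^y/2) dx`. The terms
in `Γ` combine into the deviation. -/
theorem alpha_density_misner (e : Side) (v : PrePhase) :
    muDensity n (misner C) e * (gam n (misner C) e * (v e).2 + uAct n (misner C) e (v e).1)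
      = -(boundaryCoeff C n e * deviation n e v + circleDeriv (v e).1) := by
  have hinv := circleInv_mul n e
  have h2 : algebraMap ℝ smoothCircle 2 = 2 := map_ofNat _ 2
  have h4 : algebraMap ℝ smoothCircle 4 = 4 := map_ofNat _ 4
  have h12 : algebraMap ℝ smoothCircle (1 / 2) * 2 = 1 := by
    rw [← h2, ← map_mul]; norm_num
  simp only [muDensity, gam, uAct, uField, conormal, boundaryCoeff, deviation_apply,
    Fin.sum_univ_two, misner_vol, misner_ginv_zero_zero, misner_ginv_zero_one,
    misner_ginv_one_zero, misner_ginv_one_one, map_zero, res_mul, res_algebraMap, res_yCoord,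
    Matrix.cons_val_zero, Matrix.cons_val_one, Algebra.smul_def, map_mul, h2, h4]
  generalize circleInv (n.toFun e 1) (n.transversal e) = c at *
  generalize algebraMap ℝ smoothCircle (1 / 2) = r at *
  generalize algebraMap ℝ smoothCircle (C.bdry e : ℝ) = y at *
  linear_combination (-(2 * y * c * ((v e).2 - n.toFun e 0 * circleDeriv (v e).1)
    + circleDeriv (v e).1)) * (c * n.toFun e 1 * h12 + hinv)

theorem preOmega_misner (v w : PrePhase) :
    preOmega n (misner C) v w = ∑ e, sign e * circleInt
      (boundaryCoeff C n e * (deviation n e w * (v e).1 - deviation n e v * (w e).1)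
        + (circleDeriv (w e).1 * (v e).1 - circleDeriv (v e).1 * (w e).1)) := by
  change (∑ e, sign e * circleInt (muDensity n (misner C) e * (gam n (misner C) e * (v e).2
      + uAct n (misner C) e (v e).1) * (w e).1))
    - (∑ e, sign e * circleInt (muDensity n (misner C) e * (gam n (misner C) e * (w e).2
      + uAct n (misner C) e (w e).1) * (v e).1)) = _
  rw [← Finset.sum_sub_distrib]
  refine Finset.sum_congr rfl fun e _ => ?_
  rw [← mul_sub, ← map_sub (circleInt), alpha_density_misner, alpha_density_misner]
  congr 2
  ring

end WaveCylinder

namespace WaveCylinder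

open Cylinder

variable (C : Cylinder) (n : TransversalField)

/-! ### The kernel of the presymplectic form. -/

theorem boundaryCoeff_mul_eq_one {e : Side} (he : (C.bdry e : ℝ) ≠ 0) :
    boundaryCoeff C n e * ((2 * (C.bdry e : ℝ))⁻¹ • n.toFun e 1) = 1 := by
  rw [boundaryCoeff, smul_mul_smul_comm, circleInv_mul,
    mul_inv_cancel₀ (mul_ne_zero two_ne_zero he), one_smul]

theorem eq_zero_of_boundaryCoeff_mul_eq_zero {e : Side} (he : (C.bdry e : ℝ) ≠ 0)
    {f : smoothCircle} (h : boundaryCoeff C n e * f = 0) : f = 0 := by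
  linear_combination (-f) * boundaryCoeff_mul_eq_one C n he
    + ((2 * (C.bdry e : ℝ))⁻¹ • n.toFun e 1) * h

theorem sign_ne_zero (e : Side) : sign e ≠ 0 := by
  cases e <;> simp [sign]

/-- Test data supported on one circle decouple the two boundary components. -/
theorem preOmega_misner_single (e : Side) (v : PrePhase) (x : smoothCircle × smoothCircle) :
    preOmega n (misner C) v (Pi.single e x) = sign e * circleInt
      (boundaryCoeff C n e * ((x.2 - n.toFun e 0 * circleDeriv x.1) * (v e).1
          - deviation n e v * x.1)
        + (circleDeriv x.1 * (v e).1 - circleDeriv (v e).1 * x.1)) := by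
  rw [preOmega_misner, Finset.sum_eq_single_of_mem e (Finset.mem_univ e)]
  · simp only [deviation_apply, Pi.single_eq_same]
  · intro e' _ hne
    simp [deviation_apply, Pi.single_eq_of_ne hne]

/-- Elements of the kernel of the presymplectic form satisfy the Euler-Lagrange equations of the
form at each boundary circle. -/
theorem of_mem_ker_preOmega {v : PrePhase} (hv : v ∈ LinearMap.ker (preOmega n (misner C)))
    (e : Side) :
    boundaryCoeff C n e * (v e).1 = 0 ∧
      boundaryCoeff C n e * deviation n e v + (2 : ℝ) • circleDeriv (v e).1 = 0 := by
  have key : ∀ x : smoothCircle × smoothCircle, circleInt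
      (boundaryCoeff C n e * ((x.2 - n.toFun e 0 * circleDeriv x.1) * (v e).1
          - deviation n e v * x.1)
        + (circleDeriv x.1 * (v e).1 - circleDeriv (v e).1 * x.1)) = 0 := by
    intro x
    have h := preOmega_misner_single C n e v x
    rw [LinearMap.mem_ker.1 hv, LinearMap.zero_apply] at h
    exact (mul_eq_zero.1 h.symm).resolve_left (sign_ne_zero e)
  constructor
  -- Testing with a pure normal derivative `(0, k)` leaves only the first expression.
  · refine eq_zero_of_forall_circleInt_mul fun k => ?_
    rw [← key (0, k)]
    congr 1
    simp
    ring
  · refine eq_zero_of_forall_circleInt_mul fun k => ?_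
    -- This second component makes the deviation of the test data vanish; integration by parts then
    -- frees `k` from its derivative.
    have h := key (k, n.toFun e 0 * circleDeriv k)
    have hp := circleInt_mul_circleDeriv (v e).1 k
    simp only [sub_self, zero_mul, zero_sub] at h
    rw [show boundaryCoeff C n e * -(deviation n e v * k)
        = -(boundaryCoeff C n e * (deviation n e v * k)) by ring, map_add, map_sub, map_neg,
      mul_comm (circleDeriv k), hp, mul_comm k (circleDeriv _)] at h
    rw [add_mul, map_add, smul_mul_assoc, map_smul, smul_eq_mul, mul_assoc]
    linarith

/-! ### The evolution relation, its orthogonal, and the quotient. -/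

/-- The boundary data of the field `(x, y) ↦ f x`. -/
noncomputable def pullbackData : smoothCircle →ₗ[ℝ] PrePhase where
  toFun f e := (f, n.toFun e 0 * circleDeriv f)
  map_add' f h := by
    funext e
    simp [mul_add]
  map_smul' c f := by
    funext e
    simp

theorem pullbackData_apply (f : smoothCircle) :
    pullbackData n f = fun e => (f, n.toFun e 0 * circleDeriv f) := rfl

theorem deviation_pullbackData (e : Side) (f : smoothCircle) :
    deviation n e (pullbackData n f) = 0 := sub_self _

variable {C} in
theorem prePi_pullback (f : smoothCircle) : prePi n (pullback C f) = pullbackData n f := by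
  funext e
  refine Prod.ext rfl ?_
  change normalDeriv n e (pullback C f) = n.toFun e 0 * circleDeriv f
  rw [normalDeriv, Fin.sum_univ_two, pd_one_pullback, pd_zero_pullback, map_zero, mul_zero,
    add_zero, res_pullback]

variable {C} in
theorem L_misner_eq (h0 : (0 : ℝ) ∈ Set.Icc C.lo C.hi) :
    (L n (misner C) : Set (Phase n (misner C))) =
      {v | ∃ f : smoothCircle, v = toPhase n (misner C) (pullbackData n f)} := by
  ext v
  simp only [L, SetLike.mem_coe, Submodule.mem_map, Set.mem_ofPred_eq]
  constructor
  · rintro ⟨φ, hφ, rfl⟩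
    obtain ⟨f, rfl⟩ := (mem_EL_iff_exists_pullback h0).1 hφ
    exact ⟨f, congrArg (toPhase n (misner C)) (prePi_pullback n f)⟩
  · rintro ⟨f, rfl⟩
    exact ⟨pullback C f, (mem_EL_iff_exists_pullback h0).2 ⟨f, rfl⟩,
      congrArg (toPhase n (misner C)) (prePi_pullback n f)⟩

/-- The deviation of the first argument is zero, and moving the derivative off `f` doubles the term
`∂ₓv`. Since `f` is the same on both circles, it factors out of the sum. -/
theorem preOmega_pullbackData (f : smoothCircle) (v : PrePhase) :
    preOmega n (misner C) (pullbackData n f) v = circleInt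
      ((∑ e, sign e • (boundaryCoeff C n e * deviation n e v
        + (2 : ℝ) • circleDeriv (v e).1)) * f) := by
  rw [preOmega_misner, Finset.sum_mul, map_sum]
  refine Finset.sum_congr rfl fun e _ => ?_
  rw [deviation_pullbackData, smul_mul_assoc, map_smul, smul_eq_mul]
  congr 1
  change circleInt (boundaryCoeff C n e * (deviation n e v * f - 0 * (v e).1)
    + (circleDeriv (v e).1 * f - circleDeriv f * (v e).1)) = _
  have hp := circleInt_mul_circleDeriv (v e).1 f
  rw [zero_mul, sub_zero, add_mul, ← mul_assoc, map_add, map_add, map_sub, smul_mul_assoc, map_smul,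
    smul_eq_mul, mul_comm (circleDeriv f), hp, mul_comm f]
  ring

variable {C} in
theorem toPhase_mem_orth_L_iff (h0 : (0 : ℝ) ∈ Set.Icc C.lo C.hi) (v : PrePhase) :
    toPhase n (misner C) v ∈ orth n (misner C) (L n (misner C)) ↔
      ∑ e, sign e • (boundaryCoeff C n e * deviation n e v
        + (2 : ℝ) • circleDeriv (v e).1) = 0 := by
  have h : toPhase n (misner C) v ∈ orth n (misner C) (L n (misner C)) ↔
      ∀ f, preOmega n (misner C) (pullbackData n f) v = 0 := by
    rw [orth, Submodule.mem_orthogonalBilin_iff]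
    constructor
    · intro H f
      refine H (toPhase n (misner C) (pullbackData n f)) ?_
      rw [← SetLike.mem_coe, L_misner_eq n h0]
      exact ⟨f, rfl⟩
    · intro H w hw
      rw [← SetLike.mem_coe, L_misner_eq n h0] at hw
      obtain ⟨f, rfl⟩ := hw
      exact H f
  rw [h]
  constructor
  · intro H
    refine eq_zero_of_forall_circleInt_mul fun k => ?_
    rw [← preOmega_pullbackData]
    exact H k
  · intro H f
    rw [preOmega_pullbackData, H, zero_mul, map_zero]

-- The equation of `L^⊥` receives `2∂ₓf` from each circle, with opposite orientation signs.
variable {C} in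
theorem isIsotropic_L (h0 : (0 : ℝ) ∈ Set.Icc C.lo C.hi) :
    IsIsotropic n (misner C) (L n (misner C)) := by
  intro v hv
  rw [← SetLike.mem_coe, L_misner_eq n h0] at hv
  obtain ⟨f, rfl⟩ := hv
  rw [toPhase_mem_orth_L_iff n h0]
  simp only [deviation_pullbackData, mul_zero, zero_add, Fintype.sum_bool]
  change (-1 : ℝ) • (2 : ℝ) • circleDeriv f + (1 : ℝ) • (2 : ℝ) • circleDeriv f = 0
  module

/-- Boundary data in `L^⊥` that vanish, up to a normal derivative, on the boundary circle `e` and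
are those of the field `(x, y) ↦ f x` on the other one. -/
noncomputable def oneSidedData (e : Side) : smoothCircle →ₗ[ℝ] PrePhase :=
  LinearMap.pi fun e' => if e' = e then
      LinearMap.prod 0 (LinearMap.mulLeft ℝ ((2 : ℝ) • (2 * (C.bdry e : ℝ))⁻¹ • n.toFun e 1)
        ∘ₗ circleDeriv)
    else LinearMap.proj e' ∘ₗ pullbackData n

theorem oneSidedData_same (e : Side) (f : smoothCircle) :
    oneSidedData C n e f e
      = (0, ((2 : ℝ) • (2 * (C.bdry e : ℝ))⁻¹ • n.toFun e 1) * circleDeriv f) := by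
  simp [oneSidedData]

theorem oneSidedData_not (e : Side) (f : smoothCircle) :
    oneSidedData C n e f (!e) = (f, n.toFun (!e) 0 * circleDeriv f) := by
  simp [oneSidedData, pullbackData_apply]

variable {C} in
theorem oneSidedData_mem_orth (h0 : (0 : ℝ) ∈ Set.Icc C.lo C.hi) {e : Side}
    (he : (C.bdry e : ℝ) ≠ 0) (f : smoothCircle) :
    toPhase n (misner C) (oneSidedData C n e f) ∈ orth n (misner C) (L n (misner C)) := by
  rw [toPhase_mem_orth_L_iff n h0]
  -- The multiplier in `oneSidedData` is `2/c`, chosen so that the deviation on circle `e` alone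
  -- contributes the `2∂ₓf` of the other circle.
  have h1 : boundaryCoeff C n e * deviation n e (oneSidedData C n e f)
      + (2 : ℝ) • circleDeriv (oneSidedData C n e f e).1 = (2 : ℝ) • circleDeriv f := by
    rw [deviation_apply, oneSidedData_same, map_zero, mul_zero, sub_zero, smul_zero, add_zero,
      ← mul_assoc, mul_smul_comm, boundaryCoeff_mul_eq_one C n he, smul_mul_assoc, one_mul]
  have h2 : boundaryCoeff C n (!e) * deviation n (!e) (oneSidedData C n e f)
      + (2 : ℝ) • circleDeriv (oneSidedData C n e f (!e)).1 = (2 : ℝ) • circleDeriv f := by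
    rw [deviation_apply, oneSidedData_not, sub_self, mul_zero, zero_add]
  have h3 : ∀ e', boundaryCoeff C n e' * deviation n e' (oneSidedData C n e f)
      + (2 : ℝ) • circleDeriv (oneSidedData C n e f e').1 = (2 : ℝ) • circleDeriv f := by
    intro e'
    rcases eq_or_ne e' e with rfl | hne
    · exact h1
    · rw [Bool.eq_not.2 hne]
      exact h2
  simp only [h3, Fintype.sum_bool, sign]
  module

/-- On the half-cylinders one boundary circle is the null circle `y = 0`, where `c = 0`; the other
one still serves. -/
theorem exists_bdry_ne_zero : ∃ e, (C.bdry e : ℝ) ≠ 0 := by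
  by_contra! h
  have h1 : C.lo = 0 := h false
  have h2 : C.hi = 0 := h true
  have := C.lt
  linarith

variable {C} in
theorem not_finiteDimensional_orth_quotient (h0 : (0 : ℝ) ∈ Set.Icc C.lo C.hi) :
    ¬ FiniteDimensional ℝ
      (orth n (misner C) (L n (misner C)) ⧸
        (L n (misner C)).submoduleOf (orth n (misner C) (L n (misner C)))) := by
  obtain ⟨e, he⟩ := exists_bdry_ne_zero C
  refine not_finiteDimensional_of_ker_le (Submodule.mkQ _ ∘ₗ
    LinearMap.codRestrict (orth n (misner C) (L n (misner C)))
      (toPhase n (misner C) ∘ₗ oneSidedData C n e) (oneSidedData_mem_orth n h0 he)) fun f hf => ?_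
  rw [LinearMap.mem_ker, LinearMap.comp_apply, Submodule.mkQ_apply, Submodule.Quotient.mk_eq_zero] at hf
  replace hf : toPhase n (misner C) (oneSidedData C n e f)
    ∈ (L n (misner C) : Set (Phase n (misner C))) := hf
  rw [L_misner_eq n h0] at hf
  obtain ⟨k, hk⟩ := hf
  have hker : oneSidedData C n e f - pullbackData n k ∈ LinearMap.ker (preOmega n (misner C)) :=
    (Submodule.Quotient.eq _).1 hk
  -- On circle `e`, where `c` is invertible, this forces `k = 0`. On the other circle the deviation
  -- is then zero, so `h2` reduces to `2∂ₓf = 0`: only constants become trivial in the quotient.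
  have h1 := (of_mem_ker_preOmega C n hker e).1
  have h2 := (of_mem_ker_preOmega C n hker (!e)).2
  rw [Pi.sub_apply, oneSidedData_same] at h1
  have hk0 := eq_zero_of_boundaryCoeff_mul_eq_zero C n he h1
  replace hk0 : k = 0 := by
    change 0 - k = 0 at hk0
    rwa [zero_sub, neg_eq_zero] at hk0
  rw [hk0, map_zero, sub_zero, deviation_apply, oneSidedData_not, sub_self, mul_zero, zero_add,
    smul_eq_zero] at h2
  exact h2.resolve_left two_ne_zero

variable {C} in
theorem not_isLagrangian_L (h0 : (0 : ℝ) ∈ Set.Icc C.lo C.hi) :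
    ¬ IsLagrangian n (misner C) (L n (misner C)) := by
  intro h
  refine not_finiteDimensional_orth_quotient n h0 ?_
  have htop : (L n (misner C)).submoduleOf (orth n (misner C) (L n (misner C))) = ⊤ :=
    Submodule.submoduleOf_eq_top.2 (le_of_eq (Eq.symm h))
  have := Submodule.Quotient.subsingleton_iff.2 htop
  exact Module.Finite.of_finite

/-! ### The full Misner cylinder with the distinguished transversal field -/

/-- For this `n` both `c` and `n^x` equal `-sign e`. Hence the derivative terms of the form cancel
and the orientation sign disappears. -/
theorem boundaryCoeff_fullCylinder (e : Side) :
    boundaryCoeff fullCylinder misnerNormal e = algebraMap ℝ smoothCircle (-sign e) := by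
  ext θ
  cases e
  · change (2 * (-1 : ℝ)) * (2 : ℝ)⁻¹ = -1
    norm_num
  · change (2 * (1 : ℝ)) * (2 : ℝ)⁻¹ = - -1
    norm_num

theorem misnerNormal_zero (e : Side) :
    misnerNormal.toFun e 0 = algebraMap ℝ smoothCircle (-sign e) := by
  cases e <;> simp [misnerNormal, sign]

theorem sign_mul_sign (e : Side) : sign e * sign e = 1 := by
  cases e <;> simp [sign]

theorem preOmega_fullCylinder (v w : PrePhase) :
    preOmega misnerNormal (misner fullCylinder) v w =
      ∑ e, circleInt ((v e).2 * (w e).1 - (v e).1 * (w e).2) := by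
  rw [preOmega_misner]
  refine Finset.sum_congr rfl fun e _ => ?_
  rw [← smul_eq_mul, ← map_smul]
  congr 1
  have hs : algebraMap ℝ smoothCircle (sign e) * algebraMap ℝ smoothCircle (sign e) = 1 := by
    rw [← map_mul, sign_mul_sign, map_one]
  rw [deviation_apply, deviation_apply, boundaryCoeff_fullCylinder, misnerNormal_zero,
    Algebra.smul_def, map_neg]
  generalize algebraMap ℝ smoothCircle (sign e) = s at *
  linear_combination (-((w e).2 * (v e).1 - (v e).2 * (w e).1)
    - s * (circleDeriv (w e).1 * (v e).1 - circleDeriv (v e).1 * (w e).1)) * hs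

theorem bdry_fullCylinder_ne_zero (e : Side) : (fullCylinder.bdry e : ℝ) ≠ 0 := by
  cases e
  · change (-1 : ℝ) ≠ 0
    norm_num
  · change (1 : ℝ) ≠ 0
    norm_num

theorem ker_preOmega_fullCylinder :
    LinearMap.ker (preOmega misnerNormal (misner fullCylinder)) = ⊥ := by
  refine (Submodule.eq_bot_iff _).2 fun v hv => funext fun e => ?_
  obtain ⟨h1, h2⟩ := of_mem_ker_preOmega _ _ hv e
  have hf := eq_zero_of_boundaryCoeff_mul_eq_zero _ _ (bdry_fullCylinder_ne_zero e) h1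
  rw [hf, map_zero, smul_zero, add_zero] at h2
  have hd := eq_zero_of_boundaryCoeff_mul_eq_zero _ _ (bdry_fullCylinder_ne_zero e) h2
  rw [deviation_apply, hf, map_zero, mul_zero, sub_zero] at hd
  exact Prod.ext hf hd

theorem zero_mem_fullCylinder : (0 : ℝ) ∈ Set.Icc fullCylinder.lo fullCylinder.hi := by
  constructor <;> norm_num [fullCylinder]

theorem toPhase_mem_L_fullCylinder_iff (v : PrePhase) :
    toPhase misnerNormal (misner fullCylinder) v ∈ L misnerNormal (misner fullCylinder) ↔
      ∃ f : smoothCircle, v false = (f, -circleDeriv f) ∧ v true = (f, circleDeriv f) := by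
  rw [← SetLike.mem_coe, L_misner_eq _ zero_mem_fullCylinder, Set.mem_ofPred_eq]
  refine exists_congr fun f => ?_
  have hinj : Function.Injective (toPhase misnerNormal (misner fullCylinder)) := by
    rw [← LinearMap.ker_eq_bot, toPhase, Submodule.ker_mkQ, ker_preOmega_fullCylinder]
  rw [hinj.eq_iff, pullbackData_apply, funext_iff, Bool.forall_bool]
  have hneg : (-1 : smoothCircle) * circleDeriv f = -circleDeriv f := by ring
  simp [misnerNormal_zero, sign, and_comm, hneg]

theorem toPhase_mem_orth_L_fullCylinder_iff (v : PrePhase) :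
    toPhase misnerNormal (misner fullCylinder) v ∈
        orth misnerNormal (misner fullCylinder) (L misnerNormal (misner fullCylinder)) ↔
      circleDeriv (v false).1 - (v false).2 - circleDeriv (v true).1 - (v true).2 = 0 := by
  rw [toPhase_mem_orth_L_iff _ zero_mem_fullCylinder]
  simp only [deviation_apply, boundaryCoeff_fullCylinder, misnerNormal_zero, Fintype.sum_bool, sign,
    neg_neg, map_neg, map_one, one_mul]
  rw [show (-1 : smoothCircle) * ((v false).2 - -1 * circleDeriv (v false).1)
    = -(v false).2 - circleDeriv (v false).1 by ring]
  refine Eq.congr ?_ rfl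
  module

/-- Meeting the circle `y = 0` is the only property of the three cylinders that part (1) requires.
-/
theorem zero_mem_of_misner_cylinder {C : Cylinder}
    (hC : C = fullCylinder ∨ C = lowerHalf ∨ C = upperHalf) : (0 : ℝ) ∈ Set.Icc C.lo C.hi := by
  rcases hC with rfl | rfl | rfl <;> constructor <;>
    norm_num [fullCylinder, lowerHalf, upperHalf]

end WaveCylinder

open WaveCylinder Cylinder in
theorem mainTheorem4 :
    (∀ C : Cylinder, C = fullCylinder ∨ C = lowerHalf ∨ C = upperHalf →
      ((misner C).EL : Set C.Fields) = ELglob C ∧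
      ((misner C).EL : Set C.Fields) = ELmulti C ∧
      ∀ n : TransversalField,
        (L n (misner C) : Set (Phase n (misner C))) = proj n (misner C) '' ELglob C ∧
        (L n (misner C) : Set (Phase n (misner C))) =
          {v | ∃ f : smoothCircle,
            v = toPhase n (misner C) fun e => (f, n.toFun e 0 * circleDeriv f)} ∧
        IsIsotropic n (misner C) (L n (misner C)) ∧
        ¬ FiniteDimensional ℝ
          (orth n (misner C) (L n (misner C)) ⧸
            (L n (misner C)).submoduleOf (orth n (misner C) (L n (misner C)))) ∧
        ¬ IsLagrangian n (misner C) (L n (misner C))) ∧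
    LinearMap.ker (preOmega misnerNormal (misner fullCylinder)) = ⊥ ∧
    (∀ v w : PrePhase, preOmega misnerNormal (misner fullCylinder) v w =
      ∑ e, circleInt ((v e).2 * (w e).1 - (v e).1 * (w e).2)) ∧
    (∀ v : PrePhase,
      toPhase misnerNormal (misner fullCylinder) v ∈ L misnerNormal (misner fullCylinder) ↔
        ∃ f : smoothCircle,
          v false = (f, -circleDeriv f) ∧ v true = (f, circleDeriv f)) ∧
    (∀ v : PrePhase,
      toPhase misnerNormal (misner fullCylinder) v ∈
          orth misnerNormal (misner fullCylinder) (L misnerNormal (misner fullCylinder)) ↔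
        circleDeriv (v false).1 - (v false).2 - circleDeriv (v true).1 - (v true).2 = 0) := by
  refine ⟨fun C hC => ?_, ker_preOmega_fullCylinder, preOmega_fullCylinder,
    toPhase_mem_L_fullCylinder_iff, toPhase_mem_orth_L_fullCylinder_iff⟩
  have h0 := zero_mem_of_misner_cylinder hC
  refine ⟨EL_eq_ELglob h0, EL_eq_ELmulti h0, fun n => ⟨?_, L_misner_eq n h0, isIsotropic_L n h0,
    not_finiteDimensional_orth_quotient n h0, not_isLagrangian_L n h0⟩⟩
  rw [L, Submodule.map_coe, EL_eq_ELglob h0]
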